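/- For $n\in\mathbb N$, consider the following game on the complete graph $K_n$, whose vertices are placed at the $n$-th roots of unity in the complex plane and whose edges are drawn as straight chords (so edges between consecutive vertices are included). Two players, Constructor and Blocker, alternately claim a previously unclaimed edge, Constructor moving first. Constructor may only claim an edge whose chord does not cross the chord of any edge she has already claimed (two distinct edges cross if their chords have a common point other than an endpoint), whereas Blocker may claim any unclaimed edge. The game ends when Constructor cannot claim any more edges or when all edges have been claimed. The score is the number of triangles in the graph formed by Constructor's edges at the end of the game; Constructor wants to maximize it and Blocker wants to minimize it. Let $g_{\mathrm{ECB}}(n,K_3)$ be the score under optimal play by both players. Then, as $n\to\infty$, $$(1+o(1))\,\frac n2\;\le\; g_{\mathrm{ECB}}(n,K_3)\;\le\;(1+o(1))\,\frac{2n}3 .$$ -/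

import Mathlib

open Filter Topology

namespace ECB

/-- The position of vertex `k` in the complex plane: the `n`-th root of unity `exp (2πi k / n)`. -/
noncomputable def pos {n : ℕ} (k : Fin n) : ℂ :=
  Complex.exp (2 * Real.pi * Complex.I * ((k : ℕ) : ℂ) / (n : ℂ))

/-- The straight chord drawn for an edge, without its two endpoints. -/
noncomputable def chord {n : ℕ} (e : Sym2 (Fin n)) : Set ℂ :=
  Sym2.lift ⟨fun a b => openSegment ℝ (pos a) (pos b), fun _ _ => openSegment_symm ℝ _ _⟩ e

/-- Two different edges cross if their chords share a point other than an endpoint. -/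
def Crosses {n : ℕ} (e f : Sym2 (Fin n)) : Prop :=
  e ≠ f ∧ (chord e ∩ chord f).Nonempty

/-- In a position where Constructor owns the edges in `C` and Blocker those in `B`,
the edges of `K_n` that are still unclaimed. -/
def free {n : ℕ} (C B : Finset (Sym2 (Fin n))) : Finset (Sym2 (Fin n)) :=
  (⊤ : SimpleGraph (Fin n)).edgeFinset \ (C ∪ B)

open Classical in
/-- The edges that Constructor may claim: unclaimed and crossing none of her edges. -/
noncomputable def legal {n : ℕ} (C B : Finset (Sym2 (Fin n))) : Finset (Sym2 (Fin n)) :=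
  (free C B).filter fun e => ∀ f ∈ C, ¬ Crosses e f

open Classical in
/-- The number of triangles in the graph on `Fin n` with edge set `C`. -/
noncomputable def triangles {n : ℕ} (C : Finset (Sym2 (Fin n))) : ℕ :=
  ((SimpleGraph.fromEdgeSet (C : Set (Sym2 (Fin n)))).cliqueFinset 3).card

theorem mem_free_of_mem_legal {n : ℕ} {C B : Finset (Sym2 (Fin n))} {e : Sym2 (Fin n)}
    (he : e ∈ legal C B) : e ∈ free C B := by
  classical exact (Finset.mem_filter.mp he).1

theorem card_free_insert_left {n : ℕ} {C B : Finset (Sym2 (Fin n))} {e : Sym2 (Fin n)}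
    (he : e ∈ free C B) : (free (insert e C) B).card < (free C B).card := by
  apply Finset.card_lt_card
  refine ⟨fun x hx => ?_, fun h => ?_⟩
  · simp only [free, Finset.mem_sdiff, Finset.mem_union, Finset.mem_insert] at hx ⊢
    tauto
  · have := h he
    simp [free] at this

theorem card_free_insert_right {n : ℕ} {C B : Finset (Sym2 (Fin n))} {e : Sym2 (Fin n)}
    (he : e ∈ free C B) : (free C (insert e B)).card < (free C B).card := by
  apply Finset.card_lt_card
  refine ⟨fun x hx => ?_, fun h => ?_⟩
  · simp only [free, Finset.mem_sdiff, Finset.mem_union, Finset.mem_insert] at hx ⊢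
    tauto
  · have := h he
    simp [free] at this

mutual

/-- The final score under optimal play from position `(C, B)` with Constructor to move:
she picks a legal edge maximizing the score; if she has none, the game is over. -/
noncomputable def constructorValue {n : ℕ} (C B : Finset (Sym2 (Fin n))) : ℕ :=
  if h : (legal C B).Nonempty then
    (legal C B).attach.sup' (Finset.attach_nonempty_iff.mpr h)
      fun e => blockerValue (insert e.1 C) B
  else triangles C
termination_by (free C B).card
decreasing_by exact card_free_insert_left (mem_free_of_mem_legal e.2)

/-- The final score under optimal play from position `(C, B)` with Blocker to move:
he picks an unclaimed edge minimizing the score; if there is none, the game is over. -/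
noncomputable def blockerValue {n : ℕ} (C B : Finset (Sym2 (Fin n))) : ℕ :=
  if h : (free C B).Nonempty then
    (free C B).attach.inf' (Finset.attach_nonempty_iff.mpr h)
      fun e => constructorValue C (insert e.1 B)
  else triangles C
termination_by (free C B).card
decreasing_by exact card_free_insert_right e.2

end

/-- The score `g_ECB(n, K_3)` of the embedded game: nothing is claimed yet, Constructor starts. -/
noncomputable def g (n : ℕ) : ℕ := constructorValue (n := n) ∅ ∅

end ECB

/-!
Vertices are compared by index. Signed areas of inscribed triangles show that two chords cross
exactly when their end points interleave (`crosses_of_interleave`, `not_crosses`), after which the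
proof is combinatorial. Up to additive constants the value of the game lies between `n / 2` and
`2 * n / 3`.

*Upper bound* (`three_mul_g_le`). In a noncrossing graph a triangle `a < b < c` is determined by its
middle vertex `b`, and of two consecutive vertices that are not joined at most one is a middle
vertex. So `m` pairwise disjoint polygon sides owned by Blocker leave at most `n - m` triangles
(`Sides.triangles_add_card_le`). Blocker sweeps the polygon once, always taking the first side that
is still open and skipping the next one. In each round this uses up at most two sides, and
Constructor claims at most one, so Blocker obtains about `n / 3` disjoint sides.

*Lower bound* (`le_two_mul_g_add`). Constructor maintains a set of live vertices, inside which
Blocker owns no edge, and a path through its initial segment, ending at the tip. If Blocker's edge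
does not lie inside the live set, Constructor extends the path to the next live vertex. If it leads
to a fresh vertex beyond the tip, that vertex is removed from the live set and again the path is
extended. If its upper end is an inner vertex of the path, Constructor joins the two neighbours of
that vertex; this closes a triangle and takes the vertex, with Blocker's edge, out of the live set.
The remaining case is an edge to the tip `q`. Then Constructor joins the predecessor of `q` to the
next fresh vertex `y`, which replaces `q`, and `s(q, y)` becomes a pocket: she may claim it later for
one more triangle, while Blocker spends a move if he claims it himself. With a path vertex valued
at `1` and fresh vertices and pockets at `1 / 2`, the balance is `n / 2` at the start and no round
lowers it (`Front.le_blockerValue`). With at most one fresh vertex left, the path is triangulated in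
the same way, since every edge of Blocker inside it can be cut off at one of its ends unless it
joins the two ends of the path (`Board.le_blockerValue`).
-/

namespace ECB

/-! ### Crossing chords -/

/-- Twice the signed area of the triangle `A B Z`: positive when `Z` lies to the left of the
directed line from `A` to `B`. -/
def orient (A B Z : ℂ) : ℝ :=
  (B.re - A.re) * (Z.im - A.im) - (B.im - A.im) * (Z.re - A.re)

theorem pos_eq {n : ℕ} (k : Fin n) :
    pos k = Complex.exp (((2 * (Real.pi * (k : ℕ) / n) : ℝ) : ℂ) * Complex.I) := by
  unfold pos
  congr 1
  push_cast
  ring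

theorem pos_re {n : ℕ} (k : Fin n) : (pos k).re = Real.cos (2 * (Real.pi * (k : ℕ) / n)) := by
  rw [pos_eq, Complex.exp_ofReal_mul_I_re]

theorem pos_im {n : ℕ} (k : Fin n) : (pos k).im = Real.sin (2 * (Real.pi * (k : ℕ) / n)) := by
  rw [pos_eq, Complex.exp_ofReal_mul_I_im]

/-- The signed area of an inscribed triangle factors through the sines of its half-arcs. -/
theorem orient_pos_eq {n : ℕ} (a b c : Fin n) :
    orient (pos a) (pos b) (pos c) =
      4 * Real.sin (Real.pi * (b : ℕ) / n - Real.pi * (a : ℕ) / n) *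
        Real.sin (Real.pi * (c : ℕ) / n - Real.pi * (a : ℕ) / n) *
        Real.sin (Real.pi * (c : ℕ) / n - Real.pi * (b : ℕ) / n) := by
  simp only [orient, pos_re, pos_im]
  generalize Real.pi * ((a : ℕ) : ℝ) / n = x
  generalize Real.pi * ((b : ℕ) : ℝ) / n = y
  generalize Real.pi * ((c : ℕ) : ℝ) / n = z
  have h : Real.sin (z - y) =
      Real.sin (x + z) * Real.cos (x + y) - Real.cos (x + z) * Real.sin (x + y) := by
    rw [← Real.sin_sub]
    congr 1
    ring
  rw [Real.cos_sub_cos, Real.cos_sub_cos, Real.sin_sub_sin, Real.sin_sub_sin, h,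
    show (2 * y + 2 * x) / 2 = x + y by ring, show (2 * z + 2 * x) / 2 = x + z by ring,
    show (2 * y - 2 * x) / 2 = y - x by ring, show (2 * z - 2 * x) / 2 = z - x by ring]
  ring

theorem sin_index_pos {n : ℕ} {a b : Fin n} (h : a < b) :
    0 < Real.sin (Real.pi * (b : ℕ) / n - Real.pi * (a : ℕ) / n) := by
  have hn : (0 : ℝ) < n := by exact_mod_cast a.pos
  have hab : ((a : ℕ) : ℝ) < (b : ℕ) := by exact_mod_cast h
  have hb : ((b : ℕ) : ℝ) < n := by exact_mod_cast b.isLt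
  have ha : (0 : ℝ) ≤ ((a : ℕ) : ℝ) := Nat.cast_nonneg _
  rw [← sub_div, ← mul_sub]
  apply Real.sin_pos_of_pos_of_lt_pi
  · have := Real.pi_pos
    have : 0 < ((b : ℕ) : ℝ) - (a : ℕ) := by linarith
    positivity
  · rw [div_lt_iff₀ hn]
    exact mul_lt_mul_of_pos_left (by linarith) Real.pi_pos

theorem orient_pos_of_lt {n : ℕ} {a b c : Fin n} (hab : a < b) (hbc : b < c) :
    0 < orient (pos a) (pos b) (pos c) := by
  rw [orient_pos_eq]
  have h₁ := sin_index_pos hab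
  have h₂ := sin_index_pos hbc
  have h₃ := sin_index_pos (hab.trans hbc)
  positivity

theorem orient_rotate (A B Z : ℂ) : orient B Z A = orient A B Z := by
  simp only [orient]; ring

theorem orient_swap (A B Z : ℂ) : orient A Z B = -orient A B Z := by
  simp only [orient]; ring

theorem orient_self_left (A B : ℂ) : orient A B A = 0 := by
  simp only [orient]; ring

theorem orient_self_right (A B : ℂ) : orient A B B = 0 := by
  simp only [orient]; ring

theorem orient_combo (A B C D : ℂ) {p q : ℝ} (h : p + q = 1) :
    orient A B (p • C + q • D) = p * orient A B C + q * orient A B D := by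
  obtain rfl : p = 1 - q := by linarith
  simp only [orient, Complex.add_re, Complex.add_im, Complex.real_smul, Complex.mul_re,
    Complex.mul_im, Complex.ofReal_re, Complex.ofReal_im]
  ring

/-- Vertices strictly between `a` and `b` lie to the right of the directed chord. -/
theorem orient_neg_of_between {n : ℕ} {a b c : Fin n} (hac : a < c) (hcb : c < b) :
    orient (pos a) (pos b) (pos c) < 0 := by
  rw [orient_swap]
  linarith [orient_pos_of_lt hac hcb]

/-- Vertices outside the index interval `[a, b]` lie to the left of the directed chord. -/
theorem orient_pos_of_outside {n : ℕ} {a b c : Fin n} (hab : a < b) (h : c < a ∨ b < c) :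
    0 < orient (pos a) (pos b) (pos c) := by
  rcases h with h | h
  · rw [orient_rotate]
    exact orient_pos_of_lt h hab
  · exact orient_pos_of_lt hab h

@[simp] theorem chord_mk {n : ℕ} (a b : Fin n) :
    chord s(a, b) = openSegment ℝ (pos a) (pos b) := rfl

/-- Chords whose end points interleave meet. -/
theorem crosses_of_interleave {n : ℕ} {a b c d : Fin n} (hac : a < c) (hcb : c < b)
    (hbd : b < d) : Crosses s(a, b) s(c, d) := by
  refine ⟨fun h => ?_, ?_⟩
  · rcases Sym2.eq_iff.mp h with ⟨h, -⟩ | ⟨h, -⟩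
    · exact hac.ne h
    · exact (hac.trans (hcb.trans hbd)).ne h
  have hu := orient_neg_of_between hac hcb
  have hv := orient_pos_of_outside (hac.trans hcb) (Or.inr hbd)
  have hx := orient_neg_of_between hcb hbd
  have hw := orient_pos_of_outside (hcb.trans hbd) (Or.inl hac)
  -- Both chords contain the point with barycentric weights given by the four areas.
  have hD : orient (pos c) (pos d) (pos a) - orient (pos c) (pos d) (pos b) =
      orient (pos a) (pos b) (pos d) - orient (pos a) (pos b) (pos c) := by
    simp only [orient]; ring
  set u := orient (pos a) (pos b) (pos c) with hu'
  set v := orient (pos a) (pos b) (pos d) with hv'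
  set x := orient (pos c) (pos d) (pos b) with hx'
  set w := orient (pos c) (pos d) (pos a) with hw'
  have hpos : 0 < v - u := by linarith
  have hne : v - u ≠ 0 := hpos.ne'
  rw [chord_mk, chord_mk]
  refine ⟨(v / (v - u)) • pos c + (-u / (v - u)) • pos d, ?_, ?_⟩
  · refine ⟨-x / (v - u), w / (v - u), div_pos (by linarith) hpos, div_pos hw hpos, ?_, ?_⟩
    · rw [← add_div, div_eq_one_iff_eq hne]; linarith
    · apply Complex.ext
      · simp only [Complex.add_re, Complex.real_smul, Complex.mul_re, Complex.ofReal_re,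
          Complex.ofReal_im, zero_mul, sub_zero]
        field_simp
        simp only [hu', hv', hx', hw', orient]; ring
      · simp only [Complex.add_im, Complex.real_smul, Complex.mul_im, Complex.ofReal_re,
          Complex.ofReal_im, zero_mul, add_zero]
        field_simp
        simp only [hu', hv', hx', hw', orient]; ring
  · refine ⟨v / (v - u), -u / (v - u), div_pos hv hpos, div_pos (by linarith) hpos, ?_, rfl⟩
    rw [← add_div, div_eq_one_iff_eq hne]; ring

/-- A chord with both end points weakly on one side of another chord's line, not both on it,
does not meet that chord. -/
theorem not_crosses_of_side {n : ℕ} {a b c d : Fin n} {σ : ℝ}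
    (hc : 0 ≤ σ * orient (pos a) (pos b) (pos c)) (hd : 0 ≤ σ * orient (pos a) (pos b) (pos d))
    (hne : 0 < σ * orient (pos a) (pos b) (pos c) + σ * orient (pos a) (pos b) (pos d)) :
    ¬ Crosses s(a, b) s(c, d) := by
  rintro ⟨-, z, ⟨p, q, hp, hq, hpq, rfl⟩, r, s, hr, hs, hrs, hz⟩
  have h := congrArg (orient (pos a) (pos b)) hz
  rw [orient_combo _ _ _ _ hpq, orient_combo _ _ _ _ hrs, orient_self_left,
    orient_self_right] at h
  have h' : r * (σ * orient (pos a) (pos b) (pos c)) +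
      s * (σ * orient (pos a) (pos b) (pos d)) = 0 := by linear_combination σ * h
  have h₁ := mul_nonneg hr.le hc
  have h₂ := mul_nonneg hs.le hd
  have h₃ : r * (σ * orient (pos a) (pos b) (pos c)) = 0 := by linarith
  have h₄ : s * (σ * orient (pos a) (pos b) (pos d)) = 0 := by linarith
  rcases mul_eq_zero.mp h₃ with h₃ | h₃
  · exact hr.ne' h₃
  rcases mul_eq_zero.mp h₄ with h₄ | h₄
  · exact hs.ne' h₄
  linarith

/-- Chords whose end points do not interleave do not cross. -/
theorem not_crosses {n : ℕ} {a b c d : Fin n} (hab : a < b) (hcd : c < d)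
    (h₁ : ¬ (a < c ∧ c < b ∧ b < d)) (h₂ : ¬ (c < a ∧ a < d ∧ d < b)) :
    ¬ Crosses s(a, b) s(c, d) := by
  by_cases heq : c = a ∧ d = b
  · rw [heq.1, heq.2]
    exact fun h => h.1 rfl
  have out : ∀ x : Fin n, x ≤ a ∨ b ≤ x → 0 ≤ orient (pos a) (pos b) (pos x) := by
    rintro x (hx | hx)
    · rcases hx.eq_or_lt with rfl | hx
      · rw [orient_self_left]
      · exact (orient_pos_of_outside hab (Or.inl hx)).le
    · rcases hx.eq_or_lt with rfl | hx
      · rw [orient_self_right]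
      · exact (orient_pos_of_outside hab (Or.inr hx)).le
  have inn : ∀ x : Fin n, a ≤ x → x ≤ b → orient (pos a) (pos b) (pos x) ≤ 0 := by
    intro x hx hx'
    rcases hx.eq_or_lt with rfl | hx
    · rw [orient_self_left]
    rcases hx'.eq_or_lt with rfl | hx'
    · rw [orient_self_right]
    exact (orient_neg_of_between hx hx').le
  by_cases hin : (a < c ∧ c < b) ∨ (a < d ∧ d < b)
  · have hc : a ≤ c ∧ c ≤ b := by omega
    have hd : a ≤ d ∧ d ≤ b := by omega
    have hc' := inn c hc.1 hc.2
    have hd' := inn d hd.1 hd.2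
    apply not_crosses_of_side (σ := -1) (by linarith) (by linarith)
    rcases hin with h | h
    · linarith [orient_neg_of_between h.1 h.2]
    · linarith [orient_neg_of_between h.1 h.2]
  · have hc' := out c (by omega)
    have hd' := out d (by omega)
    apply not_crosses_of_side (σ := 1) (by linarith) (by linarith)
    have : (c < a ∨ b < c) ∨ (d < a ∨ b < d) := by omega
    rcases this with h | h
    · linarith [orient_pos_of_outside hab h]
    · linarith [orient_pos_of_outside hab h]

theorem Crosses.symm {n : ℕ} {e f : Sym2 (Fin n)} (h : Crosses e f) : Crosses f e :=
  ⟨h.1.symm, by rw [Set.inter_comm]; exact h.2⟩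

/-! ### The two values of a position -/

theorem mem_free {n : ℕ} {C B : Finset (Sym2 (Fin n))} {a b : Fin n} :
    s(a, b) ∈ free C B ↔ a ≠ b ∧ s(a, b) ∉ C ∧ s(a, b) ∉ B := by
  simp [free]

theorem mem_legal {n : ℕ} {C B : Finset (Sym2 (Fin n))} {e : Sym2 (Fin n)} :
    e ∈ legal C B ↔ e ∈ free C B ∧ ∀ f ∈ C, ¬ Crosses e f := by
  classical exact Finset.mem_filter

theorem le_constructorValue {n : ℕ} {C B : Finset (Sym2 (Fin n))} {e : Sym2 (Fin n)}
    (he : e ∈ legal C B) : blockerValue (insert e C) B ≤ constructorValue C B := by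
  rw [constructorValue, dif_pos ⟨e, he⟩]
  exact Finset.le_sup' (f := fun e : {x // x ∈ legal C B} => blockerValue (insert e.1 C) B)
    (Finset.mem_attach _ ⟨e, he⟩)

theorem constructorValue_le {n : ℕ} {C B : Finset (Sym2 (Fin n))} {k : ℕ}
    (h : ∀ e ∈ legal C B, blockerValue (insert e C) B ≤ k)
    (h₀ : legal C B = ∅ → triangles C ≤ k) : constructorValue C B ≤ k := by
  rw [constructorValue]
  split_ifs with hl
  · exact Finset.sup'_le _ _ fun e _ => h e.1 e.2
  · exact h₀ (Finset.not_nonempty_iff_eq_empty.mp hl)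

theorem blockerValue_le {n : ℕ} {C B : Finset (Sym2 (Fin n))} {e : Sym2 (Fin n)}
    (he : e ∈ free C B) : blockerValue C B ≤ constructorValue C (insert e B) := by
  rw [blockerValue, dif_pos ⟨e, he⟩]
  exact Finset.inf'_le (f := fun e : {x // x ∈ free C B} => constructorValue C (insert e.1 B))
    (Finset.mem_attach _ ⟨e, he⟩)

theorem le_blockerValue {n : ℕ} {C B : Finset (Sym2 (Fin n))} {k : ℕ}
    (h : ∀ e ∈ free C B, k ≤ constructorValue C (insert e B))
    (h₀ : free C B = ∅ → k ≤ triangles C) : k ≤ blockerValue C B := by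
  rw [blockerValue]
  split_ifs with hl
  · exact Finset.le_inf' _ _ fun e _ => h e.1 e.2
  · exact h₀ (Finset.not_nonempty_iff_eq_empty.mp hl)

/-! ### Counting triangles -/

open Classical in
/-- Claiming the third side of a triangle produces a new triangle. -/
theorem triangles_insert {n : ℕ} {C : Finset (Sym2 (Fin n))} {a b v : Fin n} (hab : a ≠ b)
    (hC : s(a, b) ∉ C) (ha : s(v, a) ∈ C) (hb : s(v, b) ∈ C) (hva : v ≠ a) (hvb : v ≠ b) :
    triangles C + 1 ≤ triangles (insert s(a, b) C) := by
  apply Finset.card_lt_card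
  refine ⟨fun s hs => ?_, fun h => ?_⟩
  · rw [SimpleGraph.mem_cliqueFinset_iff] at hs ⊢
    refine hs.mono (SimpleGraph.fromEdgeSet_mono ?_)
    simp
  · have := @h {v, a, b} (by
      rw [SimpleGraph.mem_cliqueFinset_iff, SimpleGraph.is3Clique_triple_iff]
      simp [SimpleGraph.fromEdgeSet_adj, *])
    rw [SimpleGraph.mem_cliqueFinset_iff, SimpleGraph.is3Clique_triple_iff] at this
    simp [SimpleGraph.fromEdgeSet_adj, *] at this

open Classical in
theorem triangles_mono {n : ℕ} {C C' : Finset (Sym2 (Fin n))} (h : C ⊆ C') :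
    triangles C ≤ triangles C' := by
  apply Finset.card_le_card
  intro s hs
  rw [SimpleGraph.mem_cliqueFinset_iff] at hs ⊢
  exact hs.mono (SimpleGraph.fromEdgeSet_mono (by exact_mod_cast h))

/-! ### Triangles of a noncrossing graph -/

/-- The vertices that are the middle vertex, in index order, of a triangle of `C`. -/
def middles {n : ℕ} (C : Finset (Sym2 (Fin n))) : Finset (Fin n) :=
  Finset.univ.filter fun b => ∃ a c, a < b ∧ b < c ∧ s(a, b) ∈ C ∧ s(b, c) ∈ C ∧ s(a, c) ∈ C

theorem mem_middles {n : ℕ} {C : Finset (Sym2 (Fin n))} {b : Fin n} :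
    b ∈ middles C ↔
      ∃ a c, a < b ∧ b < c ∧ s(a, b) ∈ C ∧ s(b, c) ∈ C ∧ s(a, c) ∈ C := by
  simp [middles]

theorem exists_sorted_of_is3Clique {n : ℕ} {C : Finset (Sym2 (Fin n))} {t : Finset (Fin n)}
    (ht : (SimpleGraph.fromEdgeSet (C : Set (Sym2 (Fin n)))).IsNClique 3 t) :
    ∃ a b c, a < b ∧ b < c ∧ s(a, b) ∈ C ∧ s(b, c) ∈ C ∧ s(a, c) ∈ C ∧ t = {a, b, c} := by
  obtain ⟨a, b, c, hab, hac, hbc, rfl⟩ := SimpleGraph.is3Clique_iff.mp ht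
  simp only [SimpleGraph.fromEdgeSet_adj, Finset.mem_coe] at hab hac hbc
  obtain ⟨hab, hab'⟩ := hab
  obtain ⟨hac, hac'⟩ := hac
  obtain ⟨hbc, hbc'⟩ := hbc
  have hba := Sym2.eq_swap (a := a) (b := b) ▸ hab
  have hca := Sym2.eq_swap (a := a) (b := c) ▸ hac
  have hcb := Sym2.eq_swap (a := b) (b := c) ▸ hbc
  rcases lt_or_gt_of_ne hab' with h₁ | h₁ <;> rcases lt_or_gt_of_ne hac' with h₂ | h₂ <;>
    rcases lt_or_gt_of_ne hbc' with h₃ | h₃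
  · exact ⟨a, b, c, h₁, h₃, hab, hbc, hac, rfl⟩
  · exact ⟨a, c, b, h₂, h₃, hac, hcb, hab, by grind⟩
  · exact absurd (h₁.trans h₃) h₂.asymm
  · exact ⟨c, a, b, h₂, h₁, hca, hab, hcb, by grind⟩
  · exact ⟨b, a, c, h₁, h₂, hba, hac, hbc, by grind⟩
  · exact absurd (h₃.trans h₁) h₂.asymm
  · exact ⟨b, c, a, h₃, h₂, hbc, hca, hba, by grind⟩
  · exact ⟨c, b, a, h₃, h₁, hcb, hba, hca, by grind⟩

/-- No two edges of `C` cross. -/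
def Noncrossing {n : ℕ} (C : Finset (Sym2 (Fin n))) : Prop :=
  ∀ e ∈ C, ∀ f ∈ C, ¬ Crosses e f

/-- In a noncrossing graph a triangle is determined by its middle vertex. -/
theorem Noncrossing.eq_of_middle {n : ℕ} {C : Finset (Sym2 (Fin n))} (hC : Noncrossing C)
    {a b c a' c' : Fin n} (hab : a < b) (hbc : b < c) (hab' : a' < b) (hbc' : b < c')
    (h₁ : s(a, b) ∈ C) (h₂ : s(b, c) ∈ C) (h₃ : s(a, c) ∈ C)
    (h₁' : s(a', b) ∈ C) (h₂' : s(b, c') ∈ C) (h₃' : s(a', c') ∈ C) : a = a' ∧ c = c' := by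
  constructor
  · rcases lt_trichotomy a a' with h | h | h
    · exact absurd (crosses_of_interleave h hab' hbc') (hC _ h₁ _ h₃')
    · exact h
    · exact absurd (crosses_of_interleave h hab hbc) (hC _ h₁' _ h₃)
  · rcases lt_trichotomy c c' with h | h | h
    · exact absurd (crosses_of_interleave hab hbc h) (hC _ h₃ _ h₂')
    · exact h
    · exact absurd (crosses_of_interleave hab' hbc' h) (hC _ h₃' _ h₂)

open Classical in
theorem Noncrossing.triangles_le {n : ℕ} {C : Finset (Sym2 (Fin n))} (hC : Noncrossing C) :
    triangles C ≤ (middles C).card := by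
  have key : ∀ b, ∃ t : Finset (Fin n), ∀ a c, a < b → b < c → s(a, b) ∈ C → s(b, c) ∈ C →
      s(a, c) ∈ C → t = {a, b, c} := by
    intro b
    by_cases hb : b ∈ middles C
    · obtain ⟨a, c, hab, hbc, h₁, h₂, h₃⟩ := mem_middles.mp hb
      refine ⟨{a, b, c}, fun a' c' hab' hbc' h₁' h₂' h₃' => ?_⟩
      obtain ⟨rfl, rfl⟩ := hC.eq_of_middle hab hbc hab' hbc' h₁ h₂ h₃ h₁' h₂' h₃'
      rfl
    · exact ⟨∅, fun a c hab hbc h₁ h₂ h₃ =>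
        absurd (mem_middles.mpr ⟨a, c, hab, hbc, h₁, h₂, h₃⟩) hb⟩
  choose t ht using key
  apply Finset.card_le_card_of_surjOn t
  intro s hs
  rw [Finset.mem_coe, SimpleGraph.mem_cliqueFinset_iff] at hs
  obtain ⟨a, b, c, hab, hbc, h₁, h₂, h₃, rfl⟩ := exists_sorted_of_is3Clique hs
  exact ⟨b, mem_middles.mpr ⟨a, c, hab, hbc, h₁, h₂, h₃⟩, ht b a c hab hbc h₁ h₂ h₃⟩

/-- If consecutive vertices are not joined, at most one of them is a middle vertex. -/
theorem Noncrossing.not_both_middles {n : ℕ} {C : Finset (Sym2 (Fin n))} (hC : Noncrossing C)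
    {a b : Fin n} (hab : b.val = a.val + 1) (h : s(a, b) ∉ C) (ha : a ∈ middles C) :
    b ∉ middles C := by
  intro hb
  obtain ⟨-, y, -, hay, -, h₁, -⟩ := mem_middles.mp ha
  obtain ⟨x, -, hxb, -, h₂, -, -⟩ := mem_middles.mp hb
  have hy : y ≠ b := by rintro rfl; exact h h₁
  have hx : x ≠ a := by rintro rfl; exact h h₂
  exact hC _ h₂ _ h₁ (crosses_of_interleave (a := x) (b := b) (c := a) (d := y)
    (by omega) (by omega) (by omega))

/-- `M` marks pairwise disjoint polygon sides owned by Blocker, all below the index `p`; a side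
is recorded by its lower end. -/
structure Sides {n : ℕ} (B : Finset (Sym2 (Fin n))) (M : Finset (Fin n)) (p : ℕ) : Prop where
  owned : ∀ a ∈ M, ∃ b : Fin n, b.val = a.val + 1 ∧ s(a, b) ∈ B
  sep : ∀ a ∈ M, ∀ a' ∈ M, a < a' → a.val + 2 ≤ a'.val
  below : ∀ a ∈ M, a.val + 2 ≤ p

/-- Each of the disjoint sides owned by Blocker excludes its own vertex from the middles. -/
theorem Sides.triangles_add_card_le {n : ℕ} {C B : Finset (Sym2 (Fin n))} {M : Finset (Fin n)}
    {p : ℕ} (hM : Sides B M p) (hC : Noncrossing C) (hCB : Disjoint C B) :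
    triangles C + M.card ≤ n := by
  have key : ∀ a ∈ M, ∃ v, v ∉ middles C ∧ a ≤ v ∧ v.val ≤ a.val + 1 := by
    intro a ha
    obtain ⟨b, hab, hb⟩ := hM.owned a ha
    by_cases h : a ∈ middles C
    · exact ⟨b, hC.not_both_middles hab (Finset.disjoint_right.mp hCB hb) h, by omega, hab.le⟩
    · exact ⟨a, h, le_rfl, by omega⟩
  choose! v hv using key
  have h₁ : M.card ≤ (middles C)ᶜ.card := by
    apply Finset.card_le_card_of_injOn v
    · intro a ha
      simpa using (hv a ha).1
    · intro a ha a' ha' h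
      have h₁ := hv a ha
      have h₂ := hv a' ha'
      rw [h] at h₁
      rcases lt_trichotomy a a' with h | h | h
      · have := hM.sep a ha a' ha' h
        omega
      · exact h
      · have := hM.sep a' ha' a ha h
        omega
  have h₂ := Finset.card_add_card_compl (middles C)
  rw [Fintype.card_fin] at h₂
  have h₃ := hC.triangles_le
  omega

/-! ### Blocker's strategy -/

theorem Noncrossing.insert_of_legal {n : ℕ} {C B : Finset (Sym2 (Fin n))} (hC : Noncrossing C)
    {e : Sym2 (Fin n)} (he : e ∈ legal C B) : Noncrossing (insert e C) := by
  have h := (mem_legal.mp he).2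
  intro f hf f' hf'
  rcases Finset.mem_insert.mp hf with h₁ | h₁ <;> rcases Finset.mem_insert.mp hf' with h₂ | h₂
  · exact fun h => h.1 (h₁.trans h₂.symm)
  · exact h₁ ▸ h _ h₂
  · exact fun h' => h _ h₁ (h₂ ▸ h'.symm)
  · exact hC _ h₁ _ h₂

theorem not_mem_of_mem_free {n : ℕ} {C B : Finset (Sym2 (Fin n))} {e : Sym2 (Fin n)}
    (he : e ∈ free C B) : e ∉ C ∧ e ∉ B := by
  simpa [not_or] using (Finset.mem_sdiff.mp he).2

theorem disjoint_insert_left_of_free {n : ℕ} {C B : Finset (Sym2 (Fin n))} (h : Disjoint C B)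
    {e : Sym2 (Fin n)} (he : e ∈ free C B) : Disjoint (insert e C) B :=
  Finset.disjoint_insert_left.mpr ⟨(not_mem_of_mem_free he).2, h⟩

theorem disjoint_insert_right_of_free {n : ℕ} {C B : Finset (Sym2 (Fin n))} (h : Disjoint C B)
    {e : Sym2 (Fin n)} (he : e ∈ free C B) : Disjoint C (insert e B) :=
  Finset.disjoint_insert_right.mpr ⟨(not_mem_of_mem_free he).1, h⟩

theorem Sides.mono_insert {n : ℕ} {B : Finset (Sym2 (Fin n))} {M : Finset (Fin n)} {p : ℕ}
    (hM : Sides B M p) (e : Sym2 (Fin n)) : Sides (insert e B) M p where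
  owned a ha := by
    obtain ⟨b, h, h'⟩ := hM.owned a ha
    exact ⟨b, h, Finset.mem_insert_of_mem h'⟩
  sep := hM.sep
  below := hM.below

/-- However the game continues, the sides Blocker already owns bound the final score. -/
theorem Sides.values_add_card_le {n : ℕ} {M : Finset (Fin n)} {p : ℕ} (k : ℕ) :
    ∀ {C B : Finset (Sym2 (Fin n))}, (free C B).card = k → Sides B M p → Noncrossing C →
      Disjoint C B → constructorValue C B + M.card ≤ n ∧ blockerValue C B + M.card ≤ n := by
  induction k using Nat.strong_induction_on with
  | _ k ih =>
  intro C B hk hM hC hCB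
  have h₀ := hM.triangles_add_card_le hC hCB
  constructor
  · suffices constructorValue C B ≤ n - M.card by omega
    refine constructorValue_le (fun e he => ?_) fun _ => by omega
    have hf := mem_free_of_mem_legal he
    have := (ih _ (hk ▸ card_free_insert_left hf) rfl hM (hC.insert_of_legal he)
      (disjoint_insert_left_of_free hCB hf)).2
    omega
  · by_cases hf : (free C B).Nonempty
    · obtain ⟨e, he⟩ := hf
      have := (ih _ (hk ▸ card_free_insert_right he) rfl (hM.mono_insert e) hC
        (disjoint_insert_right_of_free hCB he)).1
      have := blockerValue_le he
      omega
    · rw [blockerValue, dif_neg hf]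
      exact h₀

/-- The lower ends of the polygon sides from index `p` on that Constructor does not own. -/
def openSides {n : ℕ} (C : Finset (Sym2 (Fin n))) (p : ℕ) : Finset (Fin n) :=
  Finset.univ.filter fun a => p ≤ a.val ∧ ∃ b : Fin n, b.val = a.val + 1 ∧ s(a, b) ∉ C

theorem mem_openSides {n : ℕ} {C : Finset (Sym2 (Fin n))} {p : ℕ} {a : Fin n} :
    a ∈ openSides C p ↔ p ≤ a.val ∧ ∃ b : Fin n, b.val = a.val + 1 ∧ s(a, b) ∉ C := by
  simp [openSides]

theorem card_openSides_le_insert {n : ℕ} (C : Finset (Sym2 (Fin n))) (p : ℕ)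
    (e : Sym2 (Fin n)) : (openSides C p).card ≤ (openSides (insert e C) p).card + 1 := by
  rw [← tsub_le_iff_right]
  by_cases he : ∃ a b : Fin n, b.val = a.val + 1 ∧ e = s(a, b)
  · obtain ⟨a, b, hab, rfl⟩ := he
    refine le_trans Finset.pred_card_le_card_erase (Finset.card_le_card (?_ :
      (openSides C p).erase a ⊆ _))
    intro x hx
    obtain ⟨hxa, hx⟩ := Finset.mem_erase.mp hx
    obtain ⟨hp, y, hxy, h⟩ := mem_openSides.mp hx
    refine mem_openSides.mpr ⟨hp, y, hxy, fun h' => ?_⟩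
    rcases Finset.mem_insert.mp h' with h' | h'
    · rcases Sym2.eq_iff.mp h' with ⟨h', -⟩ | ⟨h', h''⟩
      · exact hxa h'
      · subst h' h''
        omega
    · exact h h'
  · refine (Nat.sub_le _ _).trans (Finset.card_le_card ?_)
    intro x hx
    obtain ⟨hp, y, hxy, h⟩ := mem_openSides.mp hx
    refine mem_openSides.mpr ⟨hp, y, hxy, fun h' => ?_⟩
    rcases Finset.mem_insert.mp h' with h' | h'
    · exact he ⟨x, y, hxy, h'.symm⟩
    · exact h h'

theorem side_mem_legal {n : ℕ} {C B : Finset (Sym2 (Fin n))} {a b : Fin n}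
    (hC : ∀ e ∈ C, ¬ e.IsDiag) (hab : b.val = a.val + 1) (h : s(a, b) ∈ free C B) :
    s(a, b) ∈ legal C B := by
  refine mem_legal.mpr ⟨h, fun f hf => ?_⟩
  have hd := hC f hf
  induction f using Sym2.inductionOn with
  | _ x y =>
  rw [Sym2.mk_isDiag_iff] at hd
  rcases lt_or_gt_of_ne hd with h | h
  · exact not_crosses (by omega) h (by omega) (by omega)
  · rw [Sym2.eq_swap (a := x)]
    exact not_crosses (by omega) h (by omega) (by omega)

/-- Blocker always takes the first open side and skips the next one. Each of his sides thus costs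
him three open sides: the one taken, the one skipped, and one that Constructor may claim. -/
theorem Sides.constructorValue_le {n : ℕ} (k : ℕ) :
    ∀ {C B : Finset (Sym2 (Fin n))} {M : Finset (Fin n)} {p : ℕ}, (free C B).card = k →
      Sides B M p → Noncrossing C → Disjoint C B → (∀ e ∈ C, ¬ e.IsDiag) →
      (∀ a b : Fin n, p ≤ a.val → b.val = a.val + 1 → s(a, b) ∉ B) →
      3 * constructorValue C B + 3 * M.card + (openSides C p).card ≤ 3 * n + 3 := by
  induction k using Nat.strong_induction_on with
  | _ k ih =>
  intro C B M p hk hM hC hCB hdiag hB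
  by_cases hφ : (openSides C p).card ≤ 3
  · have := (hM.values_add_card_le _ rfl hC hCB).1
    omega
  suffices h : constructorValue C B ≤ (3 * n + 3 - 3 * M.card - (openSides C p).card) / 3 ∧
      3 * M.card + (openSides C p).card ≤ 3 * n + 3 by omega
  have hside : ∃ a b : Fin n, s(a, b) ∈ legal C B := by
    have : (openSides C p).Nonempty := by
      rw [← Finset.card_pos]; omega
    obtain ⟨a, ha⟩ := this
    obtain ⟨hp, b, hab, h⟩ := mem_openSides.mp ha
    refine ⟨a, b, side_mem_legal hdiag hab (mem_free.mpr ⟨?_, h, hB a b hp hab⟩)⟩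
    rintro rfl
    omega
  have hmove : ∀ e ∈ legal C B,
      3 * blockerValue (insert e C) B + 3 * M.card + (openSides C p).card ≤ 3 * n + 3 := by
    intro e he
    have hef := mem_free_of_mem_legal he
    have hlt := card_free_insert_left hef
    have hcard := card_openSides_le_insert C p e
    have hdiag' : ∀ f ∈ insert e C, ¬ f.IsDiag := by
      intro f hf
      rcases Finset.mem_insert.mp hf with rfl | hf
      · induction f using Sym2.inductionOn with
        | _ x y =>
        rw [Sym2.mk_isDiag_iff]
        exact (mem_free.mp hef).1
      · exact hdiag f hf
    have hC' := hC.insert_of_legal he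
    have hCB' := disjoint_insert_left_of_free hCB hef
    generalize insert e C = C' at *
    have hne : (openSides C' p).Nonempty := by
      rw [← Finset.card_pos]; omega
    obtain ⟨a, ha, hmin⟩ := (openSides C' p).exists_min_image (fun a => a) hne
    obtain ⟨hp, b, hab, hnC⟩ := mem_openSides.mp ha
    have hfree : s(a, b) ∈ free C' B :=
      mem_free.mpr ⟨by rintro rfl; omega, hnC, hB a b hp hab⟩
    have haM : a ∉ M := fun h => by
      have := hM.below a h
      omega
    have hM' : Sides (insert s(a, b) B) (insert a M) (a.val + 2) := by
      refine ⟨fun x hx => ?_, fun x hx y hy hxy => ?_, fun x hx => ?_⟩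
      · rcases Finset.mem_insert.mp hx with rfl | hx
        · exact ⟨b, hab, Finset.mem_insert_self _ _⟩
        · exact (hM.mono_insert _).owned x hx
      · rcases Finset.mem_insert.mp hx with h₁ | h₁ <;> rcases Finset.mem_insert.mp hy with h₂ | h₂
        · exact absurd hxy (by rw [h₁, h₂]; exact lt_irrefl _)
        · have := hM.below y h₂
          omega
        · have := hM.below x h₁
          omega
        · exact hM.sep x h₁ y h₂ hxy
      · rcases Finset.mem_insert.mp hx with rfl | hx
        · exact le_rfl
        · have := hM.below x hx
          omega
    have hB' : ∀ x y : Fin n, a.val + 2 ≤ x.val → y.val = x.val + 1 →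
        s(x, y) ∉ insert s(a, b) B := by
      intro x y hx hxy h
      rcases Finset.mem_insert.mp h with h | h
      · rcases Sym2.eq_iff.mp h with ⟨h, -⟩ | ⟨h, -⟩ <;> subst h <;> omega
      · exact hB x y (by omega) hxy h
    have hdrop : (openSides C' p).card ≤ (openSides C' (a.val + 2)).card + 2 := by
      have : openSides C' p ⊆ openSides C' (a.val + 2) ∪ {a, b} := by
        intro x hx
        have hax := hmin x hx
        simp only [Finset.mem_union, Finset.mem_insert, Finset.mem_singleton]
        by_cases h : a.val + 2 ≤ x.val
        · exact Or.inl (mem_openSides.mpr ⟨h, (mem_openSides.mp hx).2⟩)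
        · right
          omega
      calc _ ≤ _ := Finset.card_le_card this
        _ ≤ _ := Finset.card_union_le _ _
        _ ≤ _ := by gcongr; exact Finset.card_le_two
    have h₁ := ih _ (by rw [← hk]; exact (card_free_insert_right hfree).trans hlt) rfl hM' hC'
      (disjoint_insert_right_of_free hCB' hfree) hdiag' hB'
    rw [Finset.card_insert_of_notMem haM] at h₁
    have h₂ := blockerValue_le hfree
    omega
  obtain ⟨a, b, hab⟩ := hside
  have h₁ := hmove _ hab
  refine ⟨ECB.constructorValue_le (fun e he => ?_) fun h => ?_, by omega⟩
  · have := hmove e he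
    omega
  · rw [h] at hab
    simp at hab

theorem g_le (n : ℕ) : g n ≤ n :=
  (Sides.values_add_card_le (M := ∅) (p := 0) _ rfl ⟨by simp, by simp, by simp⟩
    (by simp [Noncrossing]) (by simp)).1

theorem three_mul_g_le (n : ℕ) : 3 * g n ≤ 2 * n + 4 := by
  have h := Sides.constructorValue_le (n := n) (C := ∅) (B := ∅) (M := ∅) (p := 0) _ rfl
    ⟨by simp, by simp, by simp⟩ (by simp [Noncrossing]) (by simp) (by simp) (by simp)
  have hφ : n ≤ (openSides (n := n) ∅ 0).card + 1 := by
    rcases n with _ | n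
    · omega
    have : (Finset.univ : Finset (Fin (n + 1))) ⊆ insert (Fin.last n) (openSides ∅ 0) := by
      intro a _
      by_cases ha : a = Fin.last n
      · simp [ha]
      · have := Fin.val_lt_last ha
        exact Finset.mem_insert_of_mem
          (mem_openSides.mpr ⟨by omega, ⟨a.val + 1, by omega⟩, rfl, by simp⟩)
    have := (Finset.card_le_card this).trans (Finset.card_insert_le _ _)
    simpa using this
  rw [g]
  simp only [Finset.card_empty] at h
  omega

/-! ### Positions of Constructor's strategy -/

/-- No vertex of `X` lies strictly between the two ends of `e`. -/
def Clear {n : ℕ} (X : Finset (Fin n)) (e : Sym2 (Fin n)) : Prop :=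
  ∀ a b, e = s(a, b) → ∀ c ∈ X, ¬ (a < c ∧ c < b)

theorem Clear.mono {n : ℕ} {X Y : Finset (Fin n)} {e : Sym2 (Fin n)} (h : Clear X e)
    (hY : Y ⊆ X) : Clear Y e :=
  fun a b he c hc => h a b he c (hY hc)

theorem clear_mk {n : ℕ} {X : Finset (Fin n)} {a b : Fin n} (hab : a < b)
    (h : ∀ c ∈ X, ¬ (a < c ∧ c < b)) : Clear X s(a, b) := by
  intro x y hxy c hc hc'
  rcases Sym2.eq_iff.mp hxy with ⟨rfl, rfl⟩ | ⟨rfl, rfl⟩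
  · exact h c hc hc'
  · omega

/-- An edge spanned by `X` crosses no edge that is clear of `X`. -/
theorem Clear.not_crosses {n : ℕ} {X : Finset (Fin n)} {f : Sym2 (Fin n)} (h : Clear X f)
    (hf : ¬ f.IsDiag) {u v : Fin n} (huv : u < v) (hu : u ∈ X) (hv : v ∈ X) :
    ¬ Crosses s(u, v) f := by
  induction f using Sym2.inductionOn with
  | _ a b =>
  rw [Sym2.mk_isDiag_iff] at hf
  have h₁ := h a b rfl
  have h₂ := h b a Sym2.eq_swap
  have hu₁ := h₁ u hu
  have hu₂ := h₂ u hu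
  have hv₁ := h₁ v hv
  have hv₂ := h₂ v hv
  rcases lt_or_gt_of_ne hf with h | h
  · exact ECB.not_crosses huv h (by omega) (by omega)
  · rw [Sym2.eq_swap (a := a)]
    exact ECB.not_crosses huv h (by omega) (by omega)

/-- The edges `C` of Constructor and the pockets `K` are clear of the live vertices `X`, so that
she may claim any free edge inside `X`. A pocket is an unclaimed edge with an end outside `X` that
closes a triangle of Constructor's and crosses neither her edges nor another pocket. -/
structure Board {n : ℕ} (C B : Finset (Sym2 (Fin n))) (X : Finset (Fin n))
    (K : Finset (Sym2 (Fin n))) : Prop where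
  loopless : ∀ e ∈ C ∪ K, ¬ e.IsDiag
  clear : ∀ e ∈ C ∪ K, Clear X e
  unclaimed : ∀ e ∈ K, e ∉ C ∧ e ∉ B
  uncrossed : ∀ e ∈ K, ∀ f ∈ C ∪ K, ¬ Crosses e f
  closes : ∀ e ∈ K, ∃ v a b, e = s(a, b) ∧ v ≠ a ∧ v ≠ b ∧ s(v, a) ∈ C ∧ s(v, b) ∈ C
  outside : ∀ e ∈ K, ∃ v ∈ e, v ∉ X

theorem exists_lt_of_mem_free {n : ℕ} {C B : Finset (Sym2 (Fin n))} {e : Sym2 (Fin n)}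
    (he : e ∈ free C B) : ∃ x y, x < y ∧ e = s(x, y) := by
  induction e using Sym2.inductionOn with
  | _ a b =>
  rcases lt_or_gt_of_ne (mem_free.mp he).1 with h | h
  · exact ⟨a, b, h, rfl⟩
  · exact ⟨b, a, h, Sym2.eq_swap⟩

section Board

variable {n : ℕ} {C B : Finset (Sym2 (Fin n))} {X : Finset (Fin n)} {K : Finset (Sym2 (Fin n))}

theorem Board.mono (h : Board C B X K) {Y : Finset (Fin n)} (hY : Y ⊆ X) : Board C B Y K where
  loopless := h.loopless
  clear e he := (h.clear e he).mono hY
  unclaimed := h.unclaimed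
  uncrossed := h.uncrossed
  closes := h.closes
  outside e he := by
    obtain ⟨v, hv, hvX⟩ := h.outside e he
    exact ⟨v, hv, fun h => hvX (hY h)⟩

theorem Board.not_mem_pockets (h : Board C B X K) {u v : Fin n} (hu : u ∈ X) (hv : v ∈ X) :
    s(u, v) ∉ K := by
  intro hK
  obtain ⟨w, hw, hwX⟩ := h.outside _ hK
  rcases Sym2.mem_iff.mp hw with rfl | rfl
  · exact hwX hu
  · exact hwX hv

theorem Board.blocker (h : Board C B X K) (e : Sym2 (Fin n)) :
    Board C (insert e B) X (K.erase e) := by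
  have hsub : C ∪ K.erase e ⊆ C ∪ K :=
    Finset.union_subset_union_right (Finset.erase_subset _ _)
  exact
    { loopless := fun f hf => h.loopless f (hsub hf)
      clear := fun f hf => h.clear f (hsub hf)
      unclaimed := fun f hf => by
        obtain ⟨hfe, hf⟩ := Finset.mem_erase.mp hf
        have := h.unclaimed f hf
        simp [*]
      uncrossed := fun f hf g hg => h.uncrossed f (Finset.mem_of_mem_erase hf) g (hsub hg)
      closes := fun f hf => h.closes f (Finset.mem_of_mem_erase hf)
      outside := fun f hf => h.outside f (Finset.mem_of_mem_erase hf) }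

theorem Board.mem_legal (h : Board C B X K) {u v : Fin n} (huv : u < v) (hu : u ∈ X)
    (hv : v ∈ X) (hC : s(u, v) ∉ C) (hB : s(u, v) ∉ B) : s(u, v) ∈ legal C B :=
  ECB.mem_legal.mpr ⟨mem_free.mpr ⟨huv.ne, hC, hB⟩, fun f hf =>
    (h.clear f (Finset.mem_union_left _ hf)).not_crosses
      (h.loopless f (Finset.mem_union_left _ hf)) huv hu hv⟩

theorem Board.claim (h : Board C B X K) {u v : Fin n} (huv : u < v) (hu : u ∈ X)
    (hv : v ∈ X) {Y : Finset (Fin n)} (hY : Y ⊆ X) (hgap : ∀ c ∈ Y, ¬ (u < c ∧ c < v)) :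
    Board (insert s(u, v) C) B Y K := by
  have hnot : ∀ f ∈ C ∪ K, ¬ Crosses s(u, v) f := fun f hf =>
    (h.clear f hf).not_crosses (h.loopless f hf) huv hu hv
  refine ⟨fun f hf => ?_, fun f hf => ?_, fun f hf => ?_, fun f hf g hg => ?_, fun f hf => ?_,
    (h.mono hY).outside⟩
  · rw [Finset.insert_union, Finset.mem_insert] at hf
    rcases hf with rfl | hf
    · rw [Sym2.mk_isDiag_iff]; exact huv.ne
    · exact h.loopless f hf
  · rw [Finset.insert_union, Finset.mem_insert] at hf
    rcases hf with rfl | hf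
    · exact clear_mk huv hgap
    · exact (h.clear f hf).mono hY
  · obtain ⟨h₁, h₂⟩ := h.unclaimed f hf
    refine ⟨fun h' => ?_, h₂⟩
    rcases Finset.mem_insert.mp h' with rfl | h'
    · exact h.not_mem_pockets hu hv hf
    · exact h₁ h'
  · rw [Finset.insert_union, Finset.mem_insert] at hg
    rcases hg with rfl | hg
    · exact fun h' => hnot f (Finset.mem_union_right _ hf) h'.symm
    · exact h.uncrossed f hf g hg
  · obtain ⟨w, a, b, he, ha, hb, h₁, h₂⟩ := h.closes f hf
    exact ⟨w, a, b, he, ha, hb, Finset.mem_insert_of_mem h₁, Finset.mem_insert_of_mem h₂⟩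

theorem Board.pocket_mem_legal (h : Board C B X K) {e : Sym2 (Fin n)} (he : e ∈ K) :
    e ∈ legal C B := by
  obtain ⟨v, a, b, rfl, -⟩ := h.closes e he
  have hd := h.loopless _ (Finset.mem_union_right _ he)
  rw [Sym2.mk_isDiag_iff] at hd
  exact ECB.mem_legal.mpr ⟨mem_free.mpr ⟨hd, h.unclaimed _ he⟩,
    fun f hf => h.uncrossed _ he f (Finset.mem_union_left _ hf)⟩

theorem Board.take_pocket (h : Board C B X K) {e : Sym2 (Fin n)} (he : e ∈ K) :
    Board (insert e C) B X (K.erase e) ∧ triangles C + 1 ≤ triangles (insert e C) := by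
  have hsub : insert e C ∪ K.erase e ⊆ C ∪ K := by
    intro f hf
    simp only [Finset.mem_union, Finset.mem_insert, Finset.mem_erase] at hf ⊢
    rcases hf with (rfl | hf) | hf
    · exact Or.inr he
    · exact Or.inl hf
    · exact Or.inr hf.2
  refine ⟨⟨fun f hf => h.loopless f (hsub hf), fun f hf => h.clear f (hsub hf), fun f hf => ?_,
    fun f hf g hg => h.uncrossed f (Finset.mem_of_mem_erase hf) g (hsub hg), fun f hf => ?_,
    fun f hf => h.outside f (Finset.mem_of_mem_erase hf)⟩, ?_⟩
  · obtain ⟨hne, hf⟩ := Finset.mem_erase.mp hf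
    have := h.unclaimed f hf
    simp [*]
  · obtain ⟨w, a, b, he, ha, hb, h₁, h₂⟩ := h.closes f (Finset.mem_of_mem_erase hf)
    exact ⟨w, a, b, he, ha, hb, Finset.mem_insert_of_mem h₁, Finset.mem_insert_of_mem h₂⟩
  · obtain ⟨v, a, b, rfl, hva, hvb, h₁, h₂⟩ := h.closes e he
    have hd := h.loopless _ (Finset.mem_union_right _ he)
    rw [Sym2.mk_isDiag_iff] at hd
    exact triangles_insert hd (h.unclaimed _ he).1 h₁ h₂ hva hvb

theorem Board.add_pocket (h : Board C B X K) {q y z : Fin n} (hqy : q < y)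
    (hgap : ∀ c ∈ X, ¬ (q < c ∧ c < y)) (hC : s(q, y) ∉ C) (hB : s(q, y) ∉ B)
    (hcross : ∀ f ∈ C ∪ K, ¬ Crosses s(q, y) f) (hzq : z < q) (h₁ : s(z, q) ∈ C)
    (h₂ : s(z, y) ∈ C) (hq : q ∉ X) : Board C B X (insert s(q, y) K) := by
  refine ⟨fun f hf => ?_, fun f hf => ?_, fun f hf => ?_, fun f hf g hg => ?_, fun f hf => ?_,
    fun f hf => ?_⟩
  · rw [Finset.union_insert, Finset.mem_insert] at hf
    rcases hf with rfl | hf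
    · rw [Sym2.mk_isDiag_iff]; exact hqy.ne
    · exact h.loopless f hf
  · rw [Finset.union_insert, Finset.mem_insert] at hf
    rcases hf with rfl | hf
    · exact clear_mk hqy hgap
    · exact h.clear f hf
  · rcases Finset.mem_insert.mp hf with rfl | hf
    · exact ⟨hC, hB⟩
    · exact h.unclaimed f hf
  · rw [Finset.union_insert] at hg
    rcases Finset.mem_insert.mp hf with hf | hf <;> rcases Finset.mem_insert.mp hg with hg | hg
    · exact fun h => h.1 (hf.trans hg.symm)
    · exact hf ▸ hcross g hg
    · exact fun h' => hcross f (Finset.mem_union_right _ hf) (hg ▸ h'.symm)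
    · exact h.uncrossed f hf g hg
  · rcases Finset.mem_insert.mp hf with rfl | hf
    · exact ⟨z, q, y, rfl, hzq.ne, (hzq.trans hqy).ne, h₁, h₂⟩
    · exact h.closes f hf
  · rcases Finset.mem_insert.mp hf with rfl | hf
    · exact ⟨q, Sym2.mem_mk_left _ _, hq⟩
    · exact h.outside f hf

end Board

/-- Consecutive vertices of `P` are joined by edges of `C`, which thus contains a path through
all of `P`. -/
def Chained {n : ℕ} (C : Finset (Sym2 (Fin n))) (P : Finset (Fin n)) : Prop :=
  ∀ a ∈ P, ∀ b ∈ P, a < b → (∀ c ∈ P, ¬ (a < c ∧ c < b)) → s(a, b) ∈ C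

theorem exists_pred {n : ℕ} {X : Finset (Fin n)} {b : Fin n} (h : ∃ a ∈ X, a < b) :
    ∃ a ∈ X, a < b ∧ ∀ c ∈ X, ¬ (a < c ∧ c < b) := by
  obtain ⟨a, ha, hmax⟩ := (X.filter (· < b)).exists_max_image id (by
    obtain ⟨a, ha, hab⟩ := h
    exact ⟨a, Finset.mem_filter.mpr ⟨ha, hab⟩⟩)
  rw [Finset.mem_filter] at ha
  exact ⟨a, ha.1, ha.2, fun c hc h => absurd (hmax c (Finset.mem_filter.mpr ⟨hc, h.2⟩))
    (not_le.mpr h.1)⟩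

theorem exists_succ {n : ℕ} {X : Finset (Fin n)} {b : Fin n} (h : ∃ a ∈ X, b < a) :
    ∃ a ∈ X, b < a ∧ ∀ c ∈ X, ¬ (b < c ∧ c < a) := by
  obtain ⟨a, ha, hmin⟩ := (X.filter (b < ·)).exists_min_image id (by
    obtain ⟨a, ha, hab⟩ := h
    exact ⟨a, Finset.mem_filter.mpr ⟨ha, hab⟩⟩)
  rw [Finset.mem_filter] at ha
  exact ⟨a, ha.1, ha.2, fun c hc h => absurd (hmin c (Finset.mem_filter.mpr ⟨hc, h.1⟩))
    (not_le.mpr h.2)⟩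

/-- Removing `b` between its neighbours `a` and `c` keeps the path when `s(a, c)` is added. -/
theorem Chained.cut {n : ℕ} {C : Finset (Sym2 (Fin n))} {P : Finset (Fin n)} (h : Chained C P)
    {a b c : Fin n} (ha : a ∈ P) (hc : c ∈ P) (hab : a < b) (hbc : b < c)
    (hgab : ∀ x ∈ P, ¬ (a < x ∧ x < b)) (hgbc : ∀ x ∈ P, ¬ (b < x ∧ x < c)) :
    Chained (insert s(a, c) C) (P.erase b) := by
  intro x hx y hy hxy hgap
  obtain ⟨hxb, hx⟩ := Finset.mem_erase.mp hx
  obtain ⟨hyb, hy⟩ := Finset.mem_erase.mp hy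
  by_cases hb : x < b ∧ b < y
  · have h₁ := hgab x hx
    have h₂ := hgbc y hy
    have h₃ := hgap a (Finset.mem_erase.mpr ⟨hab.ne, ha⟩)
    have h₄ := hgap c (Finset.mem_erase.mpr ⟨hbc.ne', hc⟩)
    obtain rfl : x = a := by omega
    obtain rfl : y = c := by omega
    exact Finset.mem_insert_self _ _
  · refine Finset.mem_insert_of_mem (h x hx y hy hxy fun c hc h => ?_)
    by_cases hcb : c = b
    · exact hb (hcb ▸ h)
    · exact hgap c (Finset.mem_erase.mpr ⟨hcb, hc⟩) h

/-- Cutting an ear: claiming the chord between the neighbours of `b` closes a triangle. -/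
theorem Board.cut {n : ℕ} {C B : Finset (Sym2 (Fin n))} {X : Finset (Fin n)}
    {K : Finset (Sym2 (Fin n))} (h : Board C B X K) {a b c : Fin n} (ha : a ∈ X) (hb : b ∈ X)
    (hc : c ∈ X) (hab : a < b) (hbc : b < c) (hgab : ∀ x ∈ X, ¬ (a < x ∧ x < b))
    (hgbc : ∀ x ∈ X, ¬ (b < x ∧ x < c)) (hCab : s(a, b) ∈ C) (hCbc : s(b, c) ∈ C)
    (hB : s(a, c) ∉ B) :
    s(a, c) ∈ legal C B ∧ Board (insert s(a, c) C) B (X.erase b) K ∧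
      triangles C + 1 ≤ triangles (insert s(a, c) C) := by
  have hC : s(a, c) ∉ C := fun h' =>
    h.clear _ (Finset.mem_union_left _ h') a c rfl b hb ⟨hab, hbc⟩
  refine ⟨h.mem_legal (hab.trans hbc) ha hc hC hB,
    h.claim (hab.trans hbc) ha hc (Finset.erase_subset _ _) fun x hx h' => ?_,
    triangles_insert (hab.trans hbc).ne hC (Sym2.eq_swap ▸ hCab) hCbc hab.ne' hbc.ne⟩
  obtain ⟨hxb, hx⟩ := Finset.mem_erase.mp hx
  have h₁ := hgab x hx
  have h₂ := hgbc x hx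
  omega

/-! ### Constructor's strategy once the path cannot be extended -/

/-- Constructor never loses a triangle that she has closed. -/
theorem triangles_le_values {n : ℕ} (k : ℕ) :
    ∀ {C B : Finset (Sym2 (Fin n))}, (free C B).card = k →
      triangles C ≤ constructorValue C B ∧ triangles C ≤ blockerValue C B := by
  induction k using Nat.strong_induction_on with
  | _ k ih =>
  intro C B hk
  constructor
  · by_cases hl : (legal C B).Nonempty
    · obtain ⟨e, he⟩ := hl
      have hlt := card_free_insert_left (mem_free_of_mem_legal he)
      exact (triangles_mono (Finset.subset_insert e C)).trans
        ((ih _ (hk ▸ hlt) rfl).2.trans (le_constructorValue he))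
    · rw [constructorValue, dif_neg hl]
  · exact le_blockerValue (fun e he => (ih _ (hk ▸ card_free_insert_right he) rfl).1)
      fun _ => le_rfl

/-- `b` lies strictly between two elements of `X`. -/
def Inner {n : ℕ} (X : Finset (Fin n)) (b : Fin n) : Prop :=
  b ∈ X ∧ (∃ a ∈ X, a < b) ∧ ∃ c ∈ X, b < c

/-- All of `X` lies between `a` and `b`. For `a` and `b` in `X` this makes them its least and its
greatest element. -/
def Extremes {n : ℕ} (X : Finset (Fin n)) (a b : Fin n) : Prop :=
  ∀ x ∈ X, a ≤ x ∧ x ≤ b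

/-- Blocker owns no edge inside `X`, except possibly the one joining its two extremes. -/
def AlmostFree {n : ℕ} (B : Finset (Sym2 (Fin n))) (X : Finset (Fin n)) : Prop :=
  ∀ a ∈ X, ∀ b ∈ X, a < b → s(a, b) ∈ B → Extremes X a b

theorem exists_inner {n : ℕ} {X : Finset (Fin n)} (h : 3 ≤ X.card) : ∃ b, Inner X b := by
  have hne : X.Nonempty := Finset.card_pos.mp (by omega)
  have hcard : (({X.min' hne, X.max' hne} : Finset (Fin n))).card < X.card :=
    lt_of_le_of_lt Finset.card_le_two (by omega)
  obtain ⟨b, hb, hb'⟩ := Finset.exists_mem_notMem_of_card_lt_card hcard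
  simp only [Finset.mem_insert, Finset.mem_singleton, not_or] at hb'
  exact ⟨b, hb, ⟨_, X.min'_mem hne, lt_of_le_of_ne (X.min'_le b hb) (Ne.symm hb'.1)⟩,
    ⟨_, X.max'_mem hne, lt_of_le_of_ne (X.le_max' b hb) hb'.2⟩⟩

theorem not_extremes {n : ℕ} {X : Finset (Fin n)} (hX : 4 ≤ X.card) {a b c : Fin n}
    (hgab : ∀ x ∈ X, ¬ (a < x ∧ x < b)) (hgbc : ∀ x ∈ X, ¬ (b < x ∧ x < c)) :
    ¬ Extremes X a c := by
  intro h
  have hsub : X ⊆ {a, b, c} := by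
    intro x hx
    have h₁ := h x hx
    have h₂ := hgab x hx
    have h₃ := hgbc x hx
    simp only [Finset.mem_insert, Finset.mem_singleton]
    omega
  have := (Finset.card_le_card hsub).trans Finset.card_le_three
  omega

/-- If all of Blocker's edges inside `X` that do not join its extremes have the inner vertex `b` as
an end, then cutting off `b` closes a triangle and removes those edges. The chord between the
neighbours of `b` does not join the extremes because `X` has at least four elements. -/
theorem Board.cut_inner {n : ℕ} {C B : Finset (Sym2 (Fin n))} {X : Finset (Fin n)}
    {K : Finset (Sym2 (Fin n))} (h : Board C B X K) (hch : Chained C X) (hX : 4 ≤ X.card)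
    {b : Fin n} (hb : Inner X b)
    (hB : ∀ x ∈ X, ∀ y ∈ X, x < y → s(x, y) ∈ B → Extremes X x y ∨ x = b ∨ y = b) :
    ∃ e ∈ legal C B, Board (insert e C) B (X.erase b) K ∧ Chained (insert e C) (X.erase b) ∧
      AlmostFree B (X.erase b) ∧ triangles C + 1 ≤ triangles (insert e C) := by
  obtain ⟨hbX, hlt, hgt⟩ := hb
  obtain ⟨a, ha, hab, hgab⟩ := exists_pred hlt
  obtain ⟨c, hc, hbc, hgbc⟩ := exists_succ hgt
  have hnB : s(a, c) ∉ B := fun hac => by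
    rcases hB a ha c hc (hab.trans hbc) hac with h | h | h
    · exact not_extremes hX hgab hgbc h
    · exact hab.ne h
    · exact hbc.ne' h
  obtain ⟨h₁, h₂, h₃⟩ := h.cut ha hbX hc hab hbc hgab hgbc (hch a ha b hbX hab hgab)
    (hch b hbX c hc hbc hgbc) hnB
  refine ⟨_, h₁, h₂, hch.cut ha hc hab hbc hgab hgbc, fun x hx y hy hxy hxyB => ?_, h₃⟩
  obtain ⟨hxb, hx⟩ := Finset.mem_erase.mp hx
  obtain ⟨hyb, hy⟩ := Finset.mem_erase.mp hy
  rcases hB x hx y hy hxy hxyB with h | h | h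
  · exact fun z hz => h z (Finset.mem_of_mem_erase hz)
  · exact absurd h hxb
  · exact absurd h hyb

/-- With a path through `X`, Constructor cuts off all inner vertices but one: whenever Blocker
claims an edge inside `X` with an inner end, she cuts off that end, so that no such edge remains.
After any other move of Blocker she takes a pocket while there is one, hence at least half of
them. -/
theorem Board.le_blockerValue {n : ℕ} (k : ℕ) :
    ∀ {C B : Finset (Sym2 (Fin n))} {X : Finset (Fin n)} {K : Finset (Sym2 (Fin n))},
      (free C B).card = k → Board C B X K → Chained C X → AlmostFree B X →
      triangles C + (X.card - 3) + K.card / 2 ≤ blockerValue C B := by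
  induction k using Nat.strong_induction_on with
  | _ k ih =>
  intro C B X₀ K hk hbd₀ hch₀ hfree₀
  -- At most three live vertices contribute nothing to the bound and may be forgotten.
  obtain ⟨X, hX, hbd, hch, hfree, hcard⟩ : ∃ X : Finset (Fin n), (X = ∅ ∨ 4 ≤ X.card) ∧
      Board C B X K ∧ Chained C X ∧ AlmostFree B X ∧ X.card - 3 = X₀.card - 3 := by
    by_cases h : 4 ≤ X₀.card
    · exact ⟨X₀, Or.inr h, hbd₀, hch₀, hfree₀, rfl⟩
    · exact ⟨∅, Or.inl rfl, hbd₀.mono (Finset.empty_subset _), by simp [Chained],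
        by simp [AlmostFree], by simp; omega⟩
  rw [← hcard]
  clear hcard hbd₀ hch₀ hfree₀
  have hcut : ∀ (e : Sym2 (Fin n)) (b : Fin n), e ∈ free C B → 4 ≤ X.card → Inner X b →
      (∀ x ∈ X, ∀ y ∈ X, x < y → s(x, y) ∈ insert e B → Extremes X x y ∨ x = b ∨ y = b) →
      triangles C + (X.card - 3) + (K.erase e).card / 2 ≤ constructorValue C (insert e B) := by
    intro e b he hX hb hB
    obtain ⟨c, hc, h₁, h₂, h₃, h₄⟩ := (hbd.blocker e).cut_inner hch hX hb hB
    have hlt := (card_free_insert_left (mem_free_of_mem_legal hc)).trans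
      (card_free_insert_right he)
    have := ih _ (hk ▸ hlt) rfl h₁ h₂ h₃
    rw [Finset.card_erase_of_mem hb.1] at this
    have := le_constructorValue hc
    omega
  refine ECB.le_blockerValue (fun e he => ?_) fun h => ?_
  · by_cases hin : 4 ≤ X.card ∧ ∃ b, Inner X b ∧
        ∃ x ∈ X, ∃ y ∈ X, x < y ∧ e = s(x, y) ∧ (x = b ∨ y = b)
    · obtain ⟨hX, b, hb, x, hx, y, hy, hxy, rfl, hor⟩ := hin
      have hK : K.erase s(x, y) = K := Finset.erase_eq_of_notMem (hbd.not_mem_pockets hx hy)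
      rw [← hK]
      refine hcut _ b he hX hb fun u hu v hv huv huvB => ?_
      rcases Finset.mem_insert.mp huvB with h | h
      · rcases Sym2.eq_iff.mp h with ⟨rfl, rfl⟩ | ⟨rfl, rfl⟩
        · exact Or.inr hor
        · exact absurd huv hxy.asymm
      · exact Or.inl (hfree u hu v hv huv h)
    · have hfree' : AlmostFree (insert e B) X := by
        intro x hx y hy hxy hB
        rcases Finset.mem_insert.mp hB with rfl | hB
        · have hX4 : 4 ≤ X.card := by
            rcases hX with rfl | hX
            · simp at hx
            · exact hX
          intro z hz
          constructor
          · by_contra hlt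
            exact hin ⟨hX4, x, ⟨hx, ⟨z, hz, not_le.mp hlt⟩, ⟨y, hy, hxy⟩⟩, x, hx, y, hy, hxy,
              rfl, Or.inl rfl⟩
          · by_contra hlt
            exact hin ⟨hX4, y, ⟨hy, ⟨x, hx, hxy⟩, ⟨z, hz, not_le.mp hlt⟩⟩, x, hx, y, hy, hxy,
              rfl, Or.inr rfl⟩
        · exact hfree x hx y hy hxy hB
      have hKe : K.card ≤ (K.erase e).card + 1 :=
        Nat.sub_le_iff_le_add.mp Finset.pred_card_le_card_erase
      by_cases hK : (K.erase e).Nonempty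
      · obtain ⟨p, hp⟩ := hK
        have hbd' := hbd.blocker e
        have hl := hbd'.pocket_mem_legal hp
        have hlt := (card_free_insert_left (mem_free_of_mem_legal hl)).trans
          (card_free_insert_right he)
        obtain ⟨h₁, h₂⟩ := hbd'.take_pocket hp
        have h₃ := ih _ (hk ▸ hlt) rfl h₁
          (fun a ha b hb hab hg => Finset.mem_insert_of_mem (hch a ha b hb hab hg)) hfree'
        have h₄ := le_constructorValue hl
        rw [Finset.card_erase_of_mem hp] at h₃
        have := Finset.card_pos.mpr ⟨p, hp⟩
        omega
      · rw [Finset.not_nonempty_iff_eq_empty] at hK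
        rw [hK, Finset.card_empty] at hKe
        rcases hX with rfl | hX
        · have := (triangles_le_values _ (C := C) (B := insert e B) rfl).1
          rw [Finset.card_empty]
          omega
        · obtain ⟨b, hb⟩ := exists_inner (X := X) (by omega)
          have := hcut e b he hX hb fun x hx y hy hxy hB => Or.inl (hfree' x hx y hy hxy hB)
          omega
  · have hK : K = ∅ := by
      by_contra hne
      obtain ⟨p, hp⟩ := Finset.nonempty_iff_ne_empty.mpr hne
      have := mem_free_of_mem_legal (hbd.pocket_mem_legal hp)
      rw [h] at this
      simp at this
    rcases hX with rfl | hX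
    · simp [hK]
    · obtain ⟨b, hb⟩ := exists_inner (X := X) (by omega)
      obtain ⟨c, hc, -⟩ := hbd.cut_inner hch hX hb fun x hx y hy hxy hB =>
        Or.inl (hfree x hx y hy hxy hB)
      have := mem_free_of_mem_legal hc
      rw [h] at this
      simp at this

/-! ### Constructor's strategy while the path can be extended -/

/-- The live vertices up to the tip `q` of the path. -/
def walked {n : ℕ} (X : Finset (Fin n)) (q : Fin n) : Finset (Fin n) := X.filter (· ≤ q)

/-- The live vertices beyond the tip `q` of the path. -/
def fresh {n : ℕ} (X : Finset (Fin n)) (q : Fin n) : Finset (Fin n) := X.filter (q < ·)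

theorem mem_walked {n : ℕ} {X : Finset (Fin n)} {q x : Fin n} :
    x ∈ walked X q ↔ x ∈ X ∧ x ≤ q := Finset.mem_filter

theorem mem_fresh {n : ℕ} {X : Finset (Fin n)} {q x : Fin n} :
    x ∈ fresh X q ↔ x ∈ X ∧ q < x := Finset.mem_filter

/-- Constructor owns a path through the live vertices up to its tip `q`, she has not touched the
vertices beyond `q`, and Blocker owns no edge between live vertices. -/
structure Front {n : ℕ} (C B : Finset (Sym2 (Fin n))) (X : Finset (Fin n))
    (K : Finset (Sym2 (Fin n))) (q : Fin n) : Prop extends Board C B X K where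
  tip : q ∈ X
  chained : Chained C (walked X q)
  bounded : ∀ e ∈ C, ∀ v ∈ e, v ≤ q
  unblocked : ∀ a ∈ X, ∀ b ∈ X, a < b → s(a, b) ∉ B

section Front

variable {n : ℕ} {C B : Finset (Sym2 (Fin n))} {X : Finset (Fin n)} {K : Finset (Sym2 (Fin n))}
  {q : Fin n}

/-- Constructor prolongs the path to the next live vertex. -/
theorem Front.extend (h : Front C B X K q) (hF : (fresh X q).Nonempty) :
    ∃ e ∈ legal C B, ∃ y, Front (insert e C) B X K y ∧
      (walked X y).card = (walked X q).card + 1 ∧ (fresh X y).card + 1 = (fresh X q).card := by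
  obtain ⟨y₀, hy₀⟩ := hF
  obtain ⟨y, hy, hqy, hgap⟩ := exists_succ ⟨y₀, mem_fresh.mp hy₀⟩
  have hC : s(q, y) ∉ C := fun h' =>
    absurd (h.bounded _ h' y (Sym2.mem_mk_right _ _)) (not_le.mpr hqy)
  have hw : walked X y = insert y (walked X q) := by
    ext x
    simp only [mem_walked, Finset.mem_insert]
    constructor
    · rintro ⟨hx, hxy⟩
      have := hgap x hx
      by_cases hxq : x ≤ q
      · exact Or.inr ⟨hx, hxq⟩
      · left; omega
    · rintro (rfl | ⟨hx, hxq⟩)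
      · exact ⟨hy, le_rfl⟩
      · exact ⟨hx, hxq.trans hqy.le⟩
  have hf : fresh X q = insert y (fresh X y) := by
    ext x
    simp only [mem_fresh, Finset.mem_insert]
    constructor
    · rintro ⟨hx, hxy⟩
      have := hgap x hx
      by_cases hxq : x = y
      · exact Or.inl hxq
      · exact Or.inr ⟨hx, by omega⟩
    · rintro (rfl | ⟨hx, hxq⟩)
      · exact ⟨hy, hqy⟩
      · exact ⟨hx, hqy.trans hxq⟩
  refine ⟨s(q, y), h.mem_legal hqy h.tip hy hC (h.unblocked q h.tip y hy hqy), y, ⟨?_, hy, ?_, ?_,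
    h.unblocked⟩, ?_, ?_⟩
  · exact h.claim hqy h.tip hy subset_rfl hgap
  · intro a ha b hb hab hg
    rw [hw, Finset.mem_insert] at hb
    have ha' : a ∈ walked X q := by
      rw [hw, Finset.mem_insert] at ha
      rcases ha with rfl | ha
      · rcases hb with rfl | hb
        · exact absurd hab (lt_irrefl _)
        · exact absurd (hab.trans_le (mem_walked.mp hb).2) hqy.asymm
      · exact ha
    rcases hb with rfl | hb
    · obtain rfl : a = q := by
        have := hg q (mem_walked.mpr ⟨h.tip, hqy.le⟩)
        have := (mem_walked.mp ha').2
        omega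
      exact Finset.mem_insert_self _ _
    · exact Finset.mem_insert_of_mem (h.chained a ha' b hb hab fun c hc =>
        hg c (by rw [hw]; exact Finset.mem_insert_of_mem hc))
  · intro e he v hv
    rcases Finset.mem_insert.mp he with rfl | he
    · rcases Sym2.mem_iff.mp hv with rfl | rfl
      · exact hqy.le
      · exact le_rfl
    · exact (h.bounded e he v hv).trans hqy.le
  · rw [hw, Finset.card_insert_of_notMem fun h => absurd (mem_walked.mp h).2 (not_le.mpr hqy)]
  · rw [hf, Finset.card_insert_of_notMem fun h => absurd (mem_fresh.mp h).2 (lt_irrefl _)]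

/-- Blocker claims an edge that is not inside the set of live vertices. -/
theorem Front.blocker (h : Front C B X K q) {x y : Fin n} (hxy : ¬ (x ∈ X ∧ y ∈ X)) :
    Front C (insert s(x, y) B) X (K.erase s(x, y)) q := by
  refine ⟨h.toBoard.blocker _, h.tip, h.chained, h.bounded, fun a ha b hb hab hB => ?_⟩
  rcases Finset.mem_insert.mp hB with h' | h'
  · rcases Sym2.eq_iff.mp h' with ⟨rfl, rfl⟩ | ⟨rfl, rfl⟩
    · exact hxy ⟨ha, hb⟩
    · exact hxy ⟨hb, ha⟩
  · exact h.unblocked a ha b hb hab h'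

/-- Blocker's edge to a fresh vertex kills that vertex. -/
theorem Front.blocker_fresh (h : Front C B X K q) {x y : Fin n} (hx : x ∈ X) (hy : y ∈ X)
    (hqy : q < y) : Front C (insert s(x, y) B) (X.erase y) K q ∧
      walked (X.erase y) q = walked X q ∧ (fresh (X.erase y) q).card + 1 = (fresh X q).card := by
  have hw : walked (X.erase y) q = walked X q := by
    ext z
    simp only [mem_walked, Finset.mem_erase]
    constructor
    · rintro ⟨⟨-, h₁⟩, h₂⟩
      exact ⟨h₁, h₂⟩
    · rintro ⟨h₁, h₂⟩
      exact ⟨⟨by rintro rfl; omega, h₁⟩, h₂⟩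
  have hf : fresh (X.erase y) q = (fresh X q).erase y := by
    ext z
    simp only [mem_fresh, Finset.mem_erase, and_assoc]
  have hK := h.not_mem_pockets hx hy
  have h' := (h.toBoard.mono (Finset.erase_subset y X)).blocker s(x, y)
  rw [Finset.erase_eq_of_notMem hK] at h'
  refine ⟨⟨h', Finset.mem_erase.mpr ⟨hqy.ne, h.tip⟩, hw ▸ h.chained, h.bounded,
    fun a ha b hb hab hB => ?_⟩, hw, ?_⟩
  · obtain ⟨hay, ha⟩ := Finset.mem_erase.mp ha
    obtain ⟨hby, hb⟩ := Finset.mem_erase.mp hb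
    rcases Finset.mem_insert.mp hB with h' | h'
    · rcases Sym2.eq_iff.mp h' with ⟨rfl, rfl⟩ | ⟨rfl, rfl⟩
      · exact hby rfl
      · exact hay rfl
    · exact h.unblocked a ha b hb hab h'
  · rw [hf]
    exact Finset.card_erase_add_one (mem_fresh.mpr ⟨hy, hqy⟩)

theorem unblocked_erase {x y z : Fin n} (h : ∀ a ∈ X, ∀ b ∈ X, a < b → s(a, b) ∉ B)
    (hz : z = x ∨ z = y) :
    ∀ a ∈ X.erase z, ∀ b ∈ X.erase z, a < b → s(a, b) ∉ insert s(x, y) B := by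
  intro a ha b hb hab hB
  obtain ⟨haz, ha⟩ := Finset.mem_erase.mp ha
  obtain ⟨hbz, hb⟩ := Finset.mem_erase.mp hb
  rcases Finset.mem_insert.mp hB with h' | h'
  · rcases Sym2.eq_iff.mp h' with ⟨rfl, rfl⟩ | ⟨rfl, rfl⟩ <;> rcases hz with rfl | rfl <;>
      simp at haz hbz
  · exact h a ha b hb hab h'

theorem card_walked_erase {y : Fin n} (hy : y ∈ X) (hyq : y ≤ q) :
    (walked (X.erase y) q).card + 1 = (walked X q).card := by
  have : walked (X.erase y) q = (walked X q).erase y := by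
    ext z
    simp only [mem_walked, Finset.mem_erase, and_assoc]
  rw [this]
  exact Finset.card_erase_add_one (mem_walked.mpr ⟨hy, hyq⟩)

theorem fresh_erase {y : Fin n} (hyq : y ≤ q) : fresh (X.erase y) q = fresh X q := by
  ext z
  simp only [mem_fresh, Finset.mem_erase]
  constructor
  · rintro ⟨⟨-, h₁⟩, h₂⟩
    exact ⟨h₁, h₂⟩
  · rintro ⟨h₁, h₂⟩
    exact ⟨⟨by rintro rfl; omega, h₁⟩, h₂⟩

/-- Blocker's edge with an inner vertex `y` of the path as its upper end is answered by cutting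
off `y`. -/
theorem Front.blocker_inner (h : Front C B X K q) {x y : Fin n} (hx : x ∈ X) (hy : y ∈ X)
    (hxy : x < y) (hyq : y < q) :
    ∃ e ∈ legal C (insert s(x, y) B),
      Front (insert e C) (insert s(x, y) B) (X.erase y) K q ∧
      triangles C + 1 ≤ triangles (insert e C) := by
  obtain ⟨a, ha, hay, hgay⟩ := exists_pred ⟨x, hx, hxy⟩
  obtain ⟨c, hc, hyc, hgyc⟩ := exists_succ ⟨q, h.tip, hyq⟩
  have hcq : c ≤ q := by
    have := hgyc q h.tip
    omega
  have ha' : a ∈ walked X q := mem_walked.mpr ⟨ha, hay.le.trans hyq.le⟩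
  have hy' : y ∈ walked X q := mem_walked.mpr ⟨hy, hyq.le⟩
  have hc' : c ∈ walked X q := mem_walked.mpr ⟨hc, hcq⟩
  have hw : walked (X.erase y) q = (walked X q).erase y := by
    ext z
    simp only [mem_walked, Finset.mem_erase, and_assoc]
  have hbd := h.toBoard.blocker s(x, y)
  rw [Finset.erase_eq_of_notMem (h.not_mem_pockets hx hy)] at hbd
  have hB : s(a, c) ∉ insert s(x, y) B := by
    intro hB
    rcases Finset.mem_insert.mp hB with h' | h'
    · rcases Sym2.eq_iff.mp h' with ⟨rfl, rfl⟩ | ⟨rfl, rfl⟩ <;> omega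
    · exact h.unblocked a ha c hc (hay.trans hyc) h'
  obtain ⟨h₁, h₂, h₃⟩ := hbd.cut ha hy hc hay hyc hgay hgyc
    (h.chained a ha' y hy' hay fun z hz => hgay z (mem_walked.mp hz).1)
    (h.chained y hy' c hc' hyc fun z hz => hgyc z (mem_walked.mp hz).1) hB
  refine ⟨_, h₁, ⟨h₂, Finset.mem_erase.mpr ⟨hyq.ne', h.tip⟩, ?_, ?_,
    unblocked_erase h.unblocked (Or.inr rfl)⟩, h₃⟩
  · rw [hw]
    exact h.chained.cut ha' hc' hay hyc (fun z hz => hgay z (mem_walked.mp hz).1)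
      (fun z hz => hgyc z (mem_walked.mp hz).1)
  · intro e he v hv
    rcases Finset.mem_insert.mp he with rfl | he
    · rcases Sym2.mem_iff.mp hv with rfl | rfl
      · exact hay.le.trans hyq.le
      · exact hcq
    · exact h.bounded e he v hv

/-- Blocker's edge to the tip `q` is answered by joining the predecessor of the tip to the next
fresh vertex: the new tip replaces `q`, and the edge between them becomes a pocket. -/
theorem Front.blocker_tip (h : Front C B X K q) {x : Fin n} (hx : x ∈ X) (hxq : x < q)
    (hxC : s(x, q) ∉ C) (hF : (fresh X q).Nonempty) :
    ∃ e ∈ legal C (insert s(x, q) B), ∃ y K',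
      Front (insert e C) (insert s(x, q) B) (X.erase q) K' y ∧ K'.card = K.card + 1 ∧
      (walked (X.erase q) y).card = (walked X q).card ∧
      (fresh (X.erase q) y).card + 1 = (fresh X q).card := by
  obtain ⟨y₀, hy₀⟩ := hF
  obtain ⟨y, hy, hqy, hgap⟩ := exists_succ ⟨y₀, mem_fresh.mp hy₀⟩
  obtain ⟨z, hz, hzq, hgz⟩ := exists_pred ⟨x, hx, hxq⟩
  have hzy := hzq.trans hqy
  have hz' : z ∈ walked X q := mem_walked.mpr ⟨hz, hzq.le⟩
  have hq' : q ∈ walked X q := mem_walked.mpr ⟨h.tip, le_rfl⟩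
  have hzC : s(z, q) ∈ C := h.chained z hz' q hq' hzq fun c hc => hgz c (mem_walked.mp hc).1
  have hnC : ∀ u, s(u, y) ∉ C := fun u h' =>
    absurd (h.bounded _ h' y (Sym2.mem_mk_right _ _)) (not_le.mpr hqy)
  have hnB : ∀ u ∈ X, u < y → s(u, y) ∉ insert s(x, q) B := by
    intro u hu huy hB
    rcases Finset.mem_insert.mp hB with h' | h'
    · rcases Sym2.eq_iff.mp h' with ⟨-, rfl⟩ | ⟨-, rfl⟩ <;> omega
    · exact h.unblocked u hu y hy huy h'
  have hw : walked (X.erase q) y = insert y ((walked X q).erase q) := by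
    ext v
    simp only [mem_walked, Finset.mem_insert, Finset.mem_erase]
    constructor
    · rintro ⟨⟨hvq, hv⟩, hvy⟩
      have := hgap v hv
      by_cases hvq' : v ≤ q
      · exact Or.inr ⟨hvq, hv, hvq'⟩
      · left; omega
    · rintro (rfl | ⟨hvq, hv, hvq'⟩)
      · exact ⟨⟨hqy.ne', hy⟩, le_rfl⟩
      · exact ⟨⟨hvq, hv⟩, hvq'.trans hqy.le⟩
  have hf : fresh X q = insert y (fresh (X.erase q) y) := by
    ext v
    simp only [mem_fresh, Finset.mem_insert, Finset.mem_erase]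
    constructor
    · rintro ⟨hv, hqv⟩
      have := hgap v hv
      by_cases hvy : v = y
      · exact Or.inl hvy
      · exact Or.inr ⟨⟨hqv.ne', hv⟩, by omega⟩
    · rintro (rfl | ⟨⟨-, hv⟩, hyv⟩)
      · exact ⟨hy, hqy⟩
      · exact ⟨hv, hqy.trans hyv⟩
  have hbd := h.toBoard.blocker s(x, q)
  rw [Finset.erase_eq_of_notMem (h.not_mem_pockets hx h.tip)] at hbd
  have hgap' : ∀ c ∈ X.erase q, ¬ (z < c ∧ c < y) := by
    intro c hc hc'
    obtain ⟨hcq, hc⟩ := Finset.mem_erase.mp hc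
    have h₁ := hgap c hc
    have h₂ := hgz c hc
    omega
  have hbd' := hbd.claim hzy hz hy (Finset.erase_subset q X) hgap'
  have hcross : ∀ f ∈ insert s(z, y) C ∪ K, ¬ Crosses s(q, y) f := by
    intro f hf
    rw [Finset.insert_union, Finset.mem_insert] at hf
    rcases hf with rfl | hf
    · exact not_crosses hqy hzy (by omega) (by omega)
    · exact (h.clear f hf).not_crosses (h.loopless f hf) hqy h.tip hy
  have hqC : s(q, y) ∉ insert s(z, y) C := by
    intro h'
    rcases Finset.mem_insert.mp h' with h' | h'
    · rcases Sym2.eq_iff.mp h' with ⟨h', -⟩ | ⟨h', -⟩ <;> omega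
    · exact hnC q h'
  refine ⟨s(z, y), hbd.mem_legal hzy hz hy (hnC z) (hnB z hz hzy), y, insert s(q, y) K,
    ⟨hbd'.add_pocket hqy (fun c hc => hgap c (Finset.mem_of_mem_erase hc)) hqC
      (hnB q h.tip hqy) hcross hzq (Finset.mem_insert_of_mem hzC) (Finset.mem_insert_self _ _)
      (Finset.notMem_erase _ _), Finset.mem_erase.mpr ⟨hqy.ne', hy⟩, ?_, ?_,
      unblocked_erase h.unblocked (Or.inr rfl)⟩, ?_, ?_, ?_⟩
  · intro a ha b hb hab hg
    rw [hw, Finset.mem_insert, Finset.mem_erase] at ha hb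
    have ha' : a ≠ q ∧ a ∈ walked X q := by
      rcases ha with rfl | ha
      · rcases hb with rfl | hb
        · exact absurd hab (lt_irrefl _)
        · exact absurd (hab.trans_le (mem_walked.mp hb.2).2) hqy.asymm
      · exact ha
    have haq := (mem_walked.mp ha'.2).2
    rcases hb with rfl | hb
    · obtain rfl : a = z := by
        have h₁ := hg z (by
          rw [hw]
          exact Finset.mem_insert_of_mem (Finset.mem_erase.mpr ⟨hzq.ne, hz'⟩))
        have h₂ := hgz a (mem_walked.mp ha'.2).1
        have := ha'.1
        omega
      exact Finset.mem_insert_self _ _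
    · refine Finset.mem_insert_of_mem (h.chained a ha'.2 b hb.2 hab fun c hc hc' => ?_)
      have hcq : c ≠ q := by
        rintro rfl
        have := (mem_walked.mp hb.2).2
        omega
      exact hg c (by rw [hw]; exact Finset.mem_insert_of_mem (Finset.mem_erase.mpr ⟨hcq, hc⟩)) hc'
  · intro e he v hv
    rcases Finset.mem_insert.mp he with rfl | he
    · rcases Sym2.mem_iff.mp hv with rfl | rfl
      · exact hzy.le
      · exact le_rfl
    · exact (h.bounded e he v hv).trans hqy.le
  · exact Finset.card_insert_of_notMem (h.not_mem_pockets h.tip hy)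
  · rw [hw, Finset.card_insert_of_notMem fun h => ?_, Finset.card_erase_add_one hq']
    exact absurd (mem_walked.mp (Finset.mem_of_mem_erase h)).2 (not_le.mpr hqy)
  · rw [hf, Finset.card_insert_of_notMem fun h => absurd (mem_fresh.mp h).2 (lt_irrefl _)]

end Front

/-- A path vertex is worth one triangle, a fresh vertex or a pocket half a triangle. A move of
Blocker lowers this balance by at most one half, and Constructor's answer restores it: extending
the path turns a fresh vertex into a path vertex, cutting off an ear turns a path vertex into a
triangle, and replacing the tip turns a fresh vertex into a pocket. -/
theorem Front.le_blockerValue {n : ℕ} (k : ℕ) :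
    ∀ {C B : Finset (Sym2 (Fin n))} {X : Finset (Fin n)} {K : Finset (Sym2 (Fin n))} {q : Fin n},
      (free C B).card = k → Front C B X K q →
      2 * triangles C + 2 * (walked X q).card + (fresh X q).card + K.card ≤
        2 * blockerValue C B + 8 := by
  induction k using Nat.strong_induction_on with
  | _ k ih =>
  intro C B X K q hk h
  -- With two fresh vertices, one is left to extend the path to after Blocker has killed another.
  by_cases hF : (fresh X q).card ≤ 1
  · have := (h.toBoard.mono (Y := walked X q) (Finset.filter_subset _ _)).le_blockerValue _
      rfl h.chained fun a ha b hb hab hB =>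
        absurd hB (h.unblocked a (mem_walked.mp ha).1 b (mem_walked.mp hb).1 hab)
    omega
  have hmove : ∀ e ∈ free C B,
      2 * triangles C + 2 * (walked X q).card + (fresh X q).card + K.card ≤
        2 * constructorValue C (insert e B) + 8 := by
    intro e he
    have hlt := card_free_insert_right he
    obtain ⟨x, y, hxy, rfl⟩ := exists_lt_of_mem_free he
    by_cases hin : x ∈ X ∧ y ∈ X
    · obtain ⟨hx, hy⟩ := hin
      rcases lt_trichotomy y q with hyq | rfl | hqy
      · obtain ⟨c, hc, h₁, h₂⟩ := h.blocker_inner hx hy hxy hyq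
        have h₃ := ih _ (hk ▸ (card_free_insert_left (mem_free_of_mem_legal hc)).trans hlt) rfl h₁
        have h₄ := le_constructorValue hc
        rw [fresh_erase hyq.le] at h₃
        have := card_walked_erase hy hyq.le
        omega
      · obtain ⟨c, hc, y', K', h₁, h₂, h₃, h₅⟩ := h.blocker_tip hx hxy (not_mem_of_mem_free he).1
          (Finset.card_pos.mp (by omega))
        have h₄ := ih _ (hk ▸ (card_free_insert_left (mem_free_of_mem_legal hc)).trans hlt) rfl h₁
        have := le_constructorValue hc
        have := triangles_mono (Finset.subset_insert c C)
        omega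
      · obtain ⟨h₁, h₂, h₃⟩ := h.blocker_fresh hx hy hqy
        obtain ⟨c, hc, y', h₄, h₅, h₆⟩ := h₁.extend (Finset.card_pos.mp (by omega))
        have h₇ := ih _ (hk ▸ (card_free_insert_left (mem_free_of_mem_legal hc)).trans hlt) rfl h₄
        have := le_constructorValue hc
        have := triangles_mono (Finset.subset_insert c C)
        rw [h₂] at h₅
        omega
    · obtain ⟨c, hc, y', h₄, h₅, h₆⟩ := (h.blocker hin).extend (Finset.card_pos.mp (by omega))
      have h₇ := ih _ (hk ▸ (card_free_insert_left (mem_free_of_mem_legal hc)).trans hlt) rfl h₄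
      have := le_constructorValue hc
      have := triangles_mono (Finset.subset_insert c C)
      have : K.card ≤ (K.erase s(x, y)).card + 1 :=
        Nat.sub_le_iff_le_add.mp Finset.pred_card_le_card_erase
      omega
  suffices (2 * triangles C + 2 * (walked X q).card + (fresh X q).card + K.card - 7) / 2 ≤
      blockerValue C B by omega
  refine ECB.le_blockerValue (fun e he => ?_) fun h₀ => ?_
  · have := hmove e he
    omega
  · obtain ⟨e, he, -⟩ := h.extend (Finset.card_pos.mp (by omega))
    have := mem_free_of_mem_legal he
    rw [h₀] at this
    simp at this

theorem le_two_mul_g_add (n : ℕ) : n ≤ 2 * g n + 6 := by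
  by_cases hn : n ≤ 1
  · omega
  obtain ⟨m, rfl⟩ : ∃ m, n = m + 1 := ⟨n - 1, by omega⟩
  have h₀ : Front (n := m + 1) ∅ ∅ Finset.univ ∅ 0 := by
    refine ⟨⟨by simp, by simp, by simp, by simp, by simp, by simp⟩, by simp, ?_, by simp, by simp⟩
    intro a ha b hb hab
    exact absurd (hab.trans_le (mem_walked.mp hb).2) (Fin.not_lt_zero a)
  have hw : walked (n := m + 1) Finset.univ 0 = {0} := by
    ext x
    simp [mem_walked]
  have hf : fresh (n := m + 1) Finset.univ 0 = Finset.univ.erase 0 := by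
    ext x
    simp [mem_fresh, Fin.pos_iff_ne_zero]
  have hfc : (fresh (n := m + 1) Finset.univ 0).card = m := by
    rw [hf, Finset.card_erase_of_mem (Finset.mem_univ _)]
    simp
  obtain ⟨e, he, y, h₁, h₂, h₃⟩ := h₀.extend (Finset.card_pos.mp (by omega))
  have h₄ := h₁.le_blockerValue _ rfl
  have h₅ := le_constructorValue he
  rw [hw, Finset.card_singleton] at h₂
  rw [g]
  simp only [Finset.card_empty] at h₄
  omega

end ECB

theorem theorem7 :
    (∃ ε : ℕ → ℝ, Tendsto ε atTop (𝓝 0) ∧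
      ∀ n : ℕ, (1 + ε n) * ((n : ℝ) / 2) ≤ (ECB.g n : ℝ)) ∧
    (∃ ε : ℕ → ℝ, Tendsto ε atTop (𝓝 0) ∧
      ∀ n : ℕ, (ECB.g n : ℝ) ≤ (1 + ε n) * (2 * (n : ℝ) / 3)) := by
  refine ⟨⟨fun n => -6 / n, tendsto_const_div_atTop_nhds_zero_nat _, fun n => ?_⟩,
    ⟨fun n => 2 / n, tendsto_const_div_atTop_nhds_zero_nat _, fun n => ?_⟩⟩
  · rcases n.eq_zero_or_pos with rfl | hn
    · simp
    · have hn' : (n : ℝ) ≠ 0 := by positivity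
      have h : (n : ℝ) ≤ 2 * ECB.g n + 6 := by exact_mod_cast ECB.le_two_mul_g_add n
      have : (1 + -6 / (n : ℝ)) * ((n : ℝ) / 2) = (n - 6) / 2 := by
        field_simp
        ring
      linarith
  · rcases n.eq_zero_or_pos with rfl | hn
    · -- Here `2 / n` is `0`, so that the additive constant of `three_mul_g_le` is not available.
      simp [Nat.le_zero.mp (ECB.g_le 0)]
    · have hn' : (n : ℝ) ≠ 0 := by positivity
      have h : 3 * (ECB.g n : ℝ) ≤ 2 * n + 4 := by exact_mod_cast ECB.three_mul_g_le n
      have : (1 + 2 / (n : ℝ)) * (2 * (n : ℝ) / 3) = (2 * n + 4) / 3 := by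
        field_simp
        ring
      linarith
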